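/- **Conventions.** An integer $n\ge1$ is *abundant* if $\sigma(n)>2n$; its *aliquot parts* are its positive divisors less than $n$; $n$ is *weird* if it is abundant and is not a sum of distinct aliquot parts; it is *primitive weird* if it is weird and none of its aliquot parts is weird. $\Phi_d$ denotes the value $\Phi_d(2^j)$ of the $d$-th cyclotomic polynomial. $U_m$ is the Lucas sequence with parameters $P$ and $Q=-1$: $U_0=0$, $U_1=1$, $U_{m+2}=PU_{m+1}+U_m$ (that is, $U_m=(\alpha^m-\beta^m)/(\alpha-\beta)$ with $\alpha+\beta=P$, $\alpha\beta=-1$), and $\Delta=P^2+4$. **The two tests.** Let $n$ be odd, $F=2^e$ with $e>1$, $F\mid n+1$, and suppose the Jacobi symbol satisfies $\left(\frac{\Delta}{n}\right)=-1$, $U_{n+1}\equiv0\pmod n$ and $\gcd(U_{(n+1)/2},n)=1$. Then $n$ *passes test (a)* with $P$ and $F$ if $F>\sqrt n+1$. It *passes test (b)* with $P$ and $F$ if $F>n^{1/3}+1$ and, writing $n+1=FR$ and $R=r_1F+r_0$ with $0\le r_0,r_1\le F-1$, neither $x^2+r_0x-r_1$ nor $x^2+(r_0-F)x-r_1-1$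 has a positive integral root. **Table.** Each entry lists: number. $j$; $i$; a set $A$ of divisors of $24$; the Lucas parameter $P$ and the test (a or b) for $p$, then for $q$; the numbers of decimal digits of $p$, of $q$, and of $2^kpq$. For an entry put $k=24j$, $B=\{1,2,3,4,6,8,12,24\}\setminus A$, $u=\prod_{d\in A}\Phi_d(2^j)$, $v=\prod_{d\in B}\Phi_d(2^j)$, and $$p=2^{k+1}+2^{i+1}u-1,\qquad q=2^{k+1}+2^{k-i+1}v-1 .$$ 1. $10$; $83$; $\{1,2,4,8,24\}$; 3b, 1a; $74,73,219$ 2. $10$; $86$; $\{1,2,4,6,8\}$; 12b, 3a; $73,89,234$ 3. $11$; $110$; $\{2,3,4,6,12,24\}$; 8b, 1a; $97,80,256$ 4. $11$; $114$; $\{1,3,4,6,8\}$; 5b, 1a; $80,89,248$ 5. $13$; $138$; $\{2,4,6,12\}$; 12b, 1b; $95,112,300$ 6. $14$; $113$; $\{1,2,4,12,24\}$; 3b, 1a; $102,102,305$ 7. $14$; $119$; $\{3,6\}$; 5b, 3b; $102,150,353$ 8. $15$; $169$; $\{1,2,3,4,8,12,24\}$; 13b, 1a; $151,109,368$ 9.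 $15$; $158$; $\{1,2,3,6,8\}$; 3b, 5b; $109,125,342$ 10. $16$; $145$; $\{1,4,6,8\}$; 3b, 1b; $116,145,376$ 11. $17$; $181$; $\{4,8,12,24\}$; 5b, 7a; $147,124,393$ 12. $17$; $197$; $\{1,2,3,12,24\}$; 1b, 3a; $142,124,388$ 13. $18$; $213$; $\{1,2,3,4,8,12\}$; 5b, 8a; $141,131,401$ 14. $18$; $175$; $\{1,3,4,6,12\}$; 7b, 7a; $131,149,409$ 15. $18$; $193$; $\{1,3,4,6\}$; 1b, 8b; $131,165,425$ 16. $18$; $161$; $\{6\}$; 1b, 5b; $131,202,462$ 17. $19$; $187$; $\{2,3,8,12,24\}$; 1b, 3a; $166,138,441$ 18. $19$; $214$; $\{1,6,24\}$; 1b, 5b; $138,148,423$ 19. $20$; $172$; $\{2,3,4,8,24\}$; 5b, 3a; $155,145,444$ 20. $20$; $232$; $\{1,2,4,12\}$; 5b, 1b; $145,172,461$ 21. $21$; $224$; $\{8,12,24\}$; 1b, 13a; $169,153,473$ 22. $21$; $221$; $\{1,12,24\}$; 1b, 15a; $153,156,459$ 23. $21$; $240$; $\{6,8,24\}$; 1b,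 7a; $162,153,465$ 24. $21$; $186$; $\{4,6\}$; 12b, 5b; $153,223,527$ 25. $22$; $208$; $\{3,4,6\}$; 1b, 7b; $160,216,535$ 26. $25$; $221$; $\{6,24\}$; 1b, 7a; $181,220,582$ 27. $26$; $262$; $\{3,8,12,24\}$; 1b, 12a; $221,189,597$ 28. $26$; $229$; $\{1,2,4,6,24\}$; 5b, 1a; $189,198,574$ 29. $27$; $322$; $\{1,2,3,4,6,24\}$; 7b, 7a; $228,196,618$ 30. $28$; $307$; $\{3,6,8,12,24\}$; 1b, 7a; $262,203,667$ 31. $29$; $314$; $\{1,3,6,8,12,24\}$; 5b, 3a; $279,210,698$ 32. $29$; $266$; $\{2,3,6,8\}$; 3b, 8b; $210,261,681$ 33. $30$; $252$; $\{1,3,4,6,8,12\}$; 1b, 5a; $218,223,657$ 34. $33$; $367$; $\{1,3,4,6\}$; 7b, 1b; $239,298,775$ 35. $34$; $311$; $\{1,6,8,12\}$; 7b, 3a; $246,286,777$ 36. $39$; $414$; $\{2,3,8,12\}$; 1b, 5a; $283,311,874$ 37. $40$; $452$; $\{2,4,6,8\}$; 1b, 7b; $290,334,913$ 38. $44$; $379$;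 $\{1,3,4,6,12\}$; 7b, 1a; $319,377,1013$ 39. $45$; $537$; $\{2,3,8,24\}$; 5b, 5a; $366,326,1016$ 40. $45$; $492$; $\{2,6,8,12\}$; 3b, 5a; $326,354,1004$ 41. $47$; $536$; $\{2\}$; 3b, 5b; $340,504,1184$ 42. $50$; $510$; $\{1,2,3,4,6,24\}$; 7b, 1a; $395,362,1118$ 43. $50$; $544$; $\{1,4,12\}$; 1b, 5b; $362,454,1177$ 44. $51$; $560$; $\{2,4,12,24\}$; 15b, 3a; $400,369,1137$ 45. $53$; $467$; $\{1,2,3,12,24\}$; 7b, 7a; $397,384,1163$ 46. $56$; $559$; $\{1,2,12,24\}$; 3b, 7a; $406,406,1216$ 47. $57$; $547$; $\{2,3,6,24\}$; 7b, 5a; $413,437,1261$ 48. $58$; $469$; $\{1,2,4,24\}$; 3b, 1a; $420,488,1327$ 49. $60$; $493$; $\{2,6,8,12\}$; 1b, 7a; $434,521,1388$ 50. $63$; $631$; $\{4,6,12,24\}$; 7b, 1a; $494,456,1405$ 51. $63$; $562$; $\{4,6,8,24\}$; 17b, 1a; $473,456,1384$ 52. $65$; $538$; $\{1,3,6,8\}$;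 1b, 5a; $470,602,1541$ 53. $66$; $727$; $\{1,3,6,8,24\}$; 5b, 5a; $557,478,1511$ 54. $67$; $738$; $\{2,4\}$; 3b, 1b; $485,686,1655$ 55. $72$; $639$; $\{2,3,4\}$; 1b, 5b; $521,740,1781$ 56. $73$; $722$; $\{1,3,4,6,12,24\}$; 18b, 3a; $636,528,1691$ 57. $73$; $806$; $\{1,2,12\}$; 1b, 3b; $528,681,1736$ 58. $73$; $722$; $\{1,3,4,6,12,24\}$; 18b, 3a; $636,528,1691$ 59. $73$; $806$; $\{1,2,12\}$; 1b, 3b; $528,681,1736$ 60. $75$; $892$; $\{3,8,24\}$; 1b, 5a; $585,543,1669$ 61. $75$; $846$; $\{2,4,6,24\}$; 5b, 3a; $549,543,1633$ 62. $79$; $879$; $\{1,3,24\}$; 1b, 5b; $572,616,1758$ 63. $79$; $762$; $\{6,12\}$; 5b, 5b; $572,770,1912$ 64. $85$; $939$; $\{1,4,8,12\}$; 5b, 1b; $615,665,1893$ 65. $89$; $846$; $\{2,3,4,8\}$; 7b, 1b; $644,791,2077$ 66. $90$; $767$; $\{1,3,6,8,24\}$; 3b, 7a; $692,651,1993$ **Theorem.**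 Every integer that passes test (a) or test (b) is prime. For each of the 66 entries: $0\le i\le k$, $uv=2^k-1$, $p=2^{i+1}(2^{k-i}+u)-1$, $q=2^{k-i+1}(2^i+v)-1$; $p$ and $q$ are distinct odd primes; $p$ passes the listed test with the listed parameter and $F=2^{i+1}$, and $q$ passes the listed test with the listed parameter and $F=2^{k-i+1}$; $p$, $q$ and $2^kpq$ have the listed numbers of digits; and $2^kpq$ is a primitive weird number. The 66 entries describe exactly 64 different numbers (entries 56 and 58 agree, as do entries 57 and 59), whose digit lengths have minimum 219 and maximum 2077. -/

import Mathlib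

/-- The Lucas sequence `U` with parameters `P`, `Q`. -/
def lucasU (P Q : ℤ) : ℕ → ℤ
  | 0 => 0
  | 1 => 1
  | n + 2 => P * lucasU P Q (n + 1) - Q * lucasU P Q n

/-- The closed form: `U n = (α ^ n - β ^ n) / (α - β)` where `α + β = P`, `α * β = Q`. -/
theorem lucasU_closed_form {R : Type*} [CommRing R] (α β : R) (P Q : ℤ)
    (hP : α + β = (P : R)) (hQ : α * β = (Q : R)) (n : ℕ) :
    (α - β) * (lucasU P Q n : R) = α ^ n - β ^ n := by
  induction n using Nat.strong_induction_on with
  | _ n ih =>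
    match n, ih with
    | 0, _ => simp [lucasU]
    | 1, _ => simp [lucasU]
    | m + 2, ih =>
      have h0 := ih m (by omega)
      have h1 := ih (m + 1) (by omega)
      have e : (lucasU P Q (m + 2) : R)
          = (P : R) * (lucasU P Q (m + 1) : R) - (Q : R) * (lucasU P Q m : R) := by
        simp [lucasU]
      rw [e, ← hP, ← hQ]
      linear_combination (α + β) * h1 - α * β * h0

/-- The common hypotheses of the two `n + 1` tests for the integer `n`, for the Lucas sequence with
parameters `P` and `Q = -1` (so that its discriminant is `P ^ 2 + 4`), with `F = 2 ^ e`. -/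
def LucasCondition (n : ℕ) (P : ℤ) (e : ℕ) : Prop :=
  Odd n ∧ jacobiSym (P ^ 2 + 4) n = -1 ∧ 1 < e ∧ 2 ^ e ∣ n + 1 ∧
    (n : ℤ) ∣ lucasU P (-1) (n + 1) ∧ Int.gcd (lucasU P (-1) ((n + 1) / 2)) (n : ℤ) = 1

/-- `n` passes the `n + 1` test in which `F = 2 ^ e` exceeds `√n + 1`. -/
def PassesSqrtTest (n : ℕ) (P : ℤ) (e : ℕ) : Prop :=
  LucasCondition n P e ∧ Real.sqrt n + 1 < 2 ^ e

/-- `n` passes the `n + 1` test in which `F = 2 ^ e` exceeds `n ^ (1 / 3) + 1`: with `n + 1 = F * R`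
and `R = r₁ * F + r₀` in base `F`, neither `x ^ 2 + r₀ * x - r₁` nor
`x ^ 2 + (r₀ - F) * x - r₁ - 1` has a positive integral root. -/
def PassesCbrtTest (n : ℕ) (P : ℤ) (e : ℕ) : Prop :=
  LucasCondition n P e ∧ (n : ℝ) ^ (1 / 3 : ℝ) + 1 < 2 ^ e ∧
    ∃ R r₁ r₀ : ℕ, n + 1 = 2 ^ e * R ∧ R = r₁ * 2 ^ e + r₀ ∧ r₁ < 2 ^ e ∧ r₀ < 2 ^ e ∧
      ∀ x : ℤ, 0 < x →
        x ^ 2 + r₀ * x - r₁ ≠ 0 ∧ x ^ 2 + ((r₀ : ℤ) - 2 ^ e) * x - r₁ - 1 ≠ 0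

/-- Which of the two tests is used. -/
inductive LucasTest
  | sqrtBound
  | cbrtBound

/-- `n` passes the indicated `n + 1` test with parameters `P`, `Q = -1` and `F = 2 ^ e`. -/
def LucasTest.Passes : LucasTest → ℕ → ℤ → ℕ → Prop
  | .sqrtBound => PassesSqrtTest
  | .cbrtBound => PassesCbrtTest

/-- A number is primitive weird if it is weird and none of its aliquot parts is weird. -/
def PrimitiveWeird (n : ℕ) : Prop :=
  Nat.Weird n ∧ ∀ d ∈ n.properDivisors, ¬ Nat.Weird d

/-- The product of the cyclotomic values `Φ_d (2 ^ j)` for `d ∈ A`. -/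
noncomputable def cyclotomicValue (j : ℕ) (A : Finset ℕ) : ℤ :=
  ∏ d ∈ A, (Polynomial.cyclotomic d ℤ).eval ((2 : ℤ) ^ j)

/-- The data listed with one prime `2 ^ (k + 1) + 2 ^ exponent * ∏ d ∈ A, Φ_d (2 ^ j) - 1`: the
exponent, the set `A`, the digit length of the prime, the Lucas parameter `P` and the test used. -/
structure PrimeData where
  exponent : ℕ
  A : Finset ℕ
  digitLength : ℕ
  P : ℤ
  test : LucasTest

/-- The cofactor of `2 ^ exponent` (the number `u`, respectively `v`). -/
noncomputable def PrimeData.factor (s : PrimeData) (j : ℕ) : ℤ :=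
  cyclotomicValue j s.A

/-- The number described by a `PrimeData`. -/
noncomputable def PrimeData.value (s : PrimeData) (j k : ℕ) : ℕ :=
  ((2 : ℤ) ^ (k + 1) + 2 ^ s.exponent * s.factor j - 1).toNat

/-- One entry of the table: `j`, `k`, the digit length of `2 ^ k * p * q`, the data of `p` and the
data of `q`. -/
structure Entry where
  j : ℕ
  k : ℕ
  digitLength : ℕ
  first : PrimeData
  second : PrimeData

noncomputable def Entry.u (r : Entry) : ℤ := r.first.factor r.j
noncomputable def Entry.v (r : Entry) : ℤ := r.second.factor r.j
noncomputable def Entry.p (r : Entry) : ℕ := r.first.value r.j r.k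
noncomputable def Entry.q (r : Entry) : ℕ := r.second.value r.j r.k
noncomputable def Entry.number (r : Entry) : ℕ := 2 ^ r.k * r.p * r.q

/-- The number of decimal digits. -/
def decimalLength (n : ℕ) : ℕ := (Nat.digits 10 n).length

/-- The 66 entries of the table of large weird numbers, in order. -/
def largeWeirdTable : List Entry :=
  [ ⟨10, 240, 219, ⟨84, {1, 2, 4, 8, 24}, 74, 3, .cbrtBound⟩,
     ⟨158, {3, 6, 12}, 73, 1, .sqrtBound⟩⟩,
    ⟨10, 240, 234, ⟨87, {1, 2, 4, 6, 8}, 73, 12, .cbrtBound⟩,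
     ⟨155, {3, 12, 24}, 89, 3, .sqrtBound⟩⟩,
    ⟨11, 264, 256, ⟨111, {2, 3, 4, 6, 12, 24}, 97, 8, .cbrtBound⟩,
     ⟨155, {1, 8}, 80, 1, .sqrtBound⟩⟩,
    ⟨11, 264, 248, ⟨115, {1, 3, 4, 6, 8}, 80, 5, .cbrtBound⟩,
     ⟨151, {2, 12, 24}, 89, 1, .sqrtBound⟩⟩,
    ⟨13, 312, 300, ⟨139, {2, 4, 6, 12}, 95, 12, .cbrtBound⟩,
     ⟨175, {1, 3, 8, 24}, 112, 1, .cbrtBound⟩⟩,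
    ⟨14, 336, 305, ⟨114, {1, 2, 4, 12, 24}, 102, 3, .cbrtBound⟩,
     ⟨224, {3, 6, 8}, 102, 1, .sqrtBound⟩⟩,
    ⟨14, 336, 353, ⟨120, {3, 6}, 102, 5, .cbrtBound⟩,
     ⟨218, {1, 2, 4, 8, 12, 24}, 150, 3, .cbrtBound⟩⟩,
    ⟨15, 360, 368, ⟨170, {1, 2, 3, 4, 8, 12, 24}, 151, 13, .cbrtBound⟩,
     ⟨192, {6}, 109, 1, .sqrtBound⟩⟩,
    ⟨15, 360, 342, ⟨159, {1, 2, 3, 6, 8}, 109, 3, .cbrtBound⟩,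
     ⟨203, {4, 12, 24}, 125, 5, .cbrtBound⟩⟩,
    ⟨16, 384, 376, ⟨146, {1, 4, 6, 8}, 116, 3, .cbrtBound⟩,
     ⟨240, {2, 3, 12, 24}, 145, 1, .cbrtBound⟩⟩,
    ⟨17, 408, 393, ⟨182, {4, 8, 12, 24}, 147, 5, .cbrtBound⟩,
     ⟨228, {1, 2, 3, 6}, 124, 7, .sqrtBound⟩⟩,
    ⟨17, 408, 388, ⟨198, {1, 2, 3, 12, 24}, 142, 1, .cbrtBound⟩,
     ⟨212, {4, 6, 8}, 124, 3, .sqrtBound⟩⟩,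
    ⟨18, 432, 401, ⟨214, {1, 2, 3, 4, 8, 12}, 141, 5, .cbrtBound⟩,
     ⟨220, {6, 24}, 131, 8, .sqrtBound⟩⟩,
    ⟨18, 432, 409, ⟨176, {1, 3, 4, 6, 12}, 131, 7, .cbrtBound⟩,
     ⟨258, {2, 8, 24}, 149, 7, .sqrtBound⟩⟩,
    ⟨18, 432, 425, ⟨194, {1, 3, 4, 6}, 131, 1, .cbrtBound⟩,
     ⟨240, {2, 8, 12, 24}, 165, 8, .cbrtBound⟩⟩,
    ⟨18, 432, 462, ⟨162, {6}, 131, 1, .cbrtBound⟩,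
     ⟨272, {1, 2, 3, 4, 8, 12, 24}, 202, 5, .cbrtBound⟩⟩,
    ⟨19, 456, 441, ⟨188, {2, 3, 8, 12, 24}, 166, 1, .cbrtBound⟩,
     ⟨270, {1, 4, 6}, 138, 3, .sqrtBound⟩⟩,
    ⟨19, 456, 423, ⟨215, {1, 6, 24}, 138, 1, .cbrtBound⟩,
     ⟨243, {2, 3, 4, 8, 12}, 148, 5, .cbrtBound⟩⟩,
    ⟨20, 480, 444, ⟨173, {2, 3, 4, 8, 24}, 155, 5, .cbrtBound⟩,
     ⟨309, {1, 6, 12}, 145, 3, .sqrtBound⟩⟩,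
    ⟨20, 480, 461, ⟨233, {1, 2, 4, 12}, 145, 5, .cbrtBound⟩,
     ⟨249, {3, 6, 8, 24}, 172, 1, .cbrtBound⟩⟩,
    ⟨21, 504, 473, ⟨225, {8, 12, 24}, 169, 1, .cbrtBound⟩,
     ⟨281, {1, 2, 3, 4, 6}, 153, 13, .sqrtBound⟩⟩,
    ⟨21, 504, 459, ⟨222, {1, 12, 24}, 153, 1, .cbrtBound⟩,
     ⟨284, {2, 3, 4, 6, 8}, 156, 15, .sqrtBound⟩⟩,
    ⟨21, 504, 465, ⟨241, {6, 8, 24}, 162, 1, .cbrtBound⟩,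
     ⟨265, {1, 2, 3, 4, 12}, 153, 7, .sqrtBound⟩⟩,
    ⟨21, 504, 527, ⟨187, {4, 6}, 153, 12, .cbrtBound⟩,
     ⟨319, {1, 2, 3, 8, 12, 24}, 223, 5, .cbrtBound⟩⟩,
    ⟨22, 528, 535, ⟨209, {3, 4, 6}, 160, 1, .cbrtBound⟩,
     ⟨321, {1, 2, 8, 12, 24}, 216, 7, .cbrtBound⟩⟩,
    ⟨25, 600, 582, ⟨222, {6, 24}, 181, 1, .cbrtBound⟩,
     ⟨380, {1, 2, 3, 4, 8, 12}, 220, 7, .sqrtBound⟩⟩,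
    ⟨26, 624, 597, ⟨263, {3, 8, 12, 24}, 221, 1, .cbrtBound⟩,
     ⟨363, {1, 2, 4, 6}, 189, 12, .sqrtBound⟩⟩,
    ⟨26, 624, 574, ⟨230, {1, 2, 4, 6, 24}, 189, 5, .cbrtBound⟩,
     ⟨396, {3, 8, 12}, 198, 1, .sqrtBound⟩⟩,
    ⟨27, 648, 618, ⟨323, {1, 2, 3, 4, 6, 24}, 228, 7, .cbrtBound⟩,
     ⟨327, {8, 12}, 196, 7, .sqrtBound⟩⟩,
    ⟨28, 672, 667, ⟨308, {3, 6, 8, 12, 24}, 262, 1, .cbrtBound⟩,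
     ⟨366, {1, 2, 4}, 203, 7, .sqrtBound⟩⟩,
    ⟨29, 696, 698, ⟨315, {1, 3, 6, 8, 12, 24}, 279, 5, .cbrtBound⟩,
     ⟨383, {2, 4}, 210, 3, .sqrtBound⟩⟩,
    ⟨29, 696, 681, ⟨267, {2, 3, 6, 8}, 210, 3, .cbrtBound⟩,
     ⟨431, {1, 4, 12, 24}, 261, 8, .cbrtBound⟩⟩,
    ⟨30, 720, 657, ⟨253, {1, 3, 4, 6, 8, 12}, 218, 1, .cbrtBound⟩,
     ⟨469, {2, 24}, 223, 5, .sqrtBound⟩⟩,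
    ⟨33, 792, 775, ⟨368, {1, 3, 4, 6}, 239, 7, .cbrtBound⟩,
     ⟨426, {2, 8, 12, 24}, 298, 1, .cbrtBound⟩⟩,
    ⟨34, 816, 777, ⟨312, {1, 6, 8, 12}, 246, 7, .cbrtBound⟩,
     ⟨506, {2, 3, 4, 24}, 286, 3, .sqrtBound⟩⟩,
    ⟨39, 936, 874, ⟨415, {2, 3, 8, 12}, 283, 1, .cbrtBound⟩,
     ⟨523, {1, 4, 6, 24}, 311, 5, .sqrtBound⟩⟩,
    ⟨40, 960, 913, ⟨453, {2, 4, 6, 8}, 290, 1, .cbrtBound⟩,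
     ⟨509, {1, 3, 12, 24}, 334, 7, .cbrtBound⟩⟩,
    ⟨44, 1056, 1013, ⟨380, {1, 3, 4, 6, 12}, 319, 7, .cbrtBound⟩,
     ⟨678, {2, 8, 24}, 377, 1, .sqrtBound⟩⟩,
    ⟨45, 1080, 1016, ⟨538, {2, 3, 8, 24}, 366, 5, .cbrtBound⟩,
     ⟨544, {1, 4, 6, 12}, 326, 5, .sqrtBound⟩⟩,
    ⟨45, 1080, 1004, ⟨493, {2, 6, 8, 12}, 326, 3, .cbrtBound⟩,
     ⟨589, {1, 3, 4, 24}, 354, 5, .sqrtBound⟩⟩,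
    ⟨47, 1128, 1184, ⟨537, {2}, 340, 3, .cbrtBound⟩,
     ⟨593, {1, 3, 4, 6, 8, 12, 24}, 504, 5, .cbrtBound⟩⟩,
    ⟨50, 1200, 1118, ⟨511, {1, 2, 3, 4, 6, 24}, 395, 7, .cbrtBound⟩,
     ⟨691, {8, 12}, 362, 1, .sqrtBound⟩⟩,
    ⟨50, 1200, 1177, ⟨545, {1, 4, 12}, 362, 1, .cbrtBound⟩,
     ⟨657, {2, 3, 6, 8, 24}, 454, 5, .cbrtBound⟩⟩,
    ⟨51, 1224, 1137, ⟨561, {2, 4, 12, 24}, 400, 15, .cbrtBound⟩,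
     ⟨665, {1, 3, 6, 8}, 369, 3, .sqrtBound⟩⟩,
    ⟨53, 1272, 1163, ⟨468, {1, 2, 3, 12, 24}, 397, 7, .cbrtBound⟩,
     ⟨806, {4, 6, 8}, 384, 7, .sqrtBound⟩⟩,
    ⟨56, 1344, 1216, ⟨560, {1, 2, 12, 24}, 406, 3, .cbrtBound⟩,
     ⟨786, {3, 4, 6, 8}, 406, 7, .sqrtBound⟩⟩,
    ⟨57, 1368, 1261, ⟨548, {2, 3, 6, 24}, 413, 7, .cbrtBound⟩,
     ⟨822, {1, 4, 8, 12}, 437, 5, .sqrtBound⟩⟩,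
    ⟨58, 1392, 1327, ⟨470, {1, 2, 4, 24}, 420, 3, .cbrtBound⟩,
     ⟨924, {3, 6, 8, 12}, 488, 1, .sqrtBound⟩⟩,
    ⟨60, 1440, 1388, ⟨494, {2, 6, 8, 12}, 434, 1, .cbrtBound⟩,
     ⟨948, {1, 3, 4, 24}, 521, 7, .sqrtBound⟩⟩,
    ⟨63, 1512, 1405, ⟨632, {4, 6, 12, 24}, 494, 7, .cbrtBound⟩,
     ⟨882, {1, 2, 3, 8}, 456, 1, .sqrtBound⟩⟩,
    ⟨63, 1512, 1384, ⟨563, {4, 6, 8, 24}, 473, 17, .cbrtBound⟩,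
     ⟨951, {1, 2, 3, 12}, 456, 1, .sqrtBound⟩⟩,
    ⟨65, 1560, 1541, ⟨539, {1, 3, 6, 8}, 470, 1, .cbrtBound⟩,
     ⟨1023, {2, 4, 12, 24}, 602, 5, .sqrtBound⟩⟩,
    ⟨66, 1584, 1511, ⟨728, {1, 3, 6, 8, 24}, 557, 5, .cbrtBound⟩,
     ⟨858, {2, 4, 12}, 478, 5, .sqrtBound⟩⟩,
    ⟨67, 1608, 1655, ⟨739, {2, 4}, 485, 3, .cbrtBound⟩,
     ⟨871, {1, 3, 6, 8, 12, 24}, 686, 1, .cbrtBound⟩⟩,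
    ⟨72, 1728, 1781, ⟨640, {2, 3, 4}, 521, 1, .cbrtBound⟩,
     ⟨1090, {1, 6, 8, 12, 24}, 740, 5, .cbrtBound⟩⟩,
    ⟨73, 1752, 1691, ⟨723, {1, 3, 4, 6, 12, 24}, 636, 18, .cbrtBound⟩,
     ⟨1031, {2, 8}, 528, 3, .sqrtBound⟩⟩,
    ⟨73, 1752, 1736, ⟨807, {1, 2, 12}, 528, 1, .cbrtBound⟩,
     ⟨947, {3, 4, 6, 8, 24}, 681, 3, .cbrtBound⟩⟩,
    ⟨73, 1752, 1691, ⟨723, {1, 3, 4, 6, 12, 24}, 636, 18, .cbrtBound⟩,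
     ⟨1031, {2, 8}, 528, 3, .sqrtBound⟩⟩,
    ⟨73, 1752, 1736, ⟨807, {1, 2, 12}, 528, 1, .cbrtBound⟩,
     ⟨947, {3, 4, 6, 8, 24}, 681, 3, .cbrtBound⟩⟩,
    ⟨75, 1800, 1669, ⟨893, {3, 8, 24}, 585, 1, .cbrtBound⟩,
     ⟨909, {1, 2, 4, 6, 12}, 543, 5, .sqrtBound⟩⟩,
    ⟨75, 1800, 1633, ⟨847, {2, 4, 6, 24}, 549, 5, .cbrtBound⟩,
     ⟨955, {1, 3, 8, 12}, 543, 3, .sqrtBound⟩⟩,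
    ⟨79, 1896, 1758, ⟨880, {1, 3, 24}, 572, 1, .cbrtBound⟩,
     ⟨1018, {2, 4, 6, 8, 12}, 616, 5, .cbrtBound⟩⟩,
    ⟨79, 1896, 1912, ⟨763, {6, 12}, 572, 5, .cbrtBound⟩,
     ⟨1135, {1, 2, 3, 4, 8, 24}, 770, 5, .cbrtBound⟩⟩,
    ⟨85, 2040, 1893, ⟨940, {1, 4, 8, 12}, 615, 5, .cbrtBound⟩,
     ⟨1102, {2, 3, 6, 24}, 665, 1, .cbrtBound⟩⟩,
    ⟨89, 2136, 2077, ⟨847, {2, 3, 4, 8}, 644, 7, .cbrtBound⟩,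
     ⟨1291, {1, 6, 12, 24}, 791, 1, .cbrtBound⟩⟩,
    ⟨90, 2160, 1993, ⟨768, {1, 3, 6, 8, 24}, 692, 3, .cbrtBound⟩,
     ⟨1394, {2, 4, 12}, 651, 7, .sqrtBound⟩⟩ ]

/-- A divisor of `N` that does not divide `N / 2` is divisible by every power of `2` dividing `N`. -/
theorem two_pow_dvd_of_dvd_of_not_dvd_half {d N e : ℕ} (hd : d ∣ N) (hN : 2 ∣ N)
    (hd' : ¬ d ∣ N / 2) (he : 2 ^ e ∣ N) : 2 ^ e ∣ d := by
  obtain ⟨c, rfl⟩ := hd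
  have hc : ¬ 2 ∣ c := by
    rintro ⟨b, rfl⟩
    exact hd' ⟨b, by rw [show d * (2 * b) = 2 * (d * b) by ring, Nat.mul_div_cancel_left _ two_pos]⟩
  exact ((Nat.prime_two.coprime_iff_not_dvd.mpr hc).pow_left e).dvd_of_dvd_mul_right he

/-- If `2 ^ e ∣ n + 1` and the rank of apparition of a prime `l` in a Lucas sequence divides `n + 1`
but not `(n + 1) / 2`, then `l ≡ ±1 (mod 2 ^ e)`, with the sign of the quadratic character of the
discriminant. -/
theorem two_pow_dvd_of_lucasU (K : Type*) [Field K] [IsAlgClosed K] {l : ℕ} [Fact l.Prime]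
    [Algebra (ZMod l) K] (hl : l ≠ 2) {P : ℤ} {N e : ℕ}
    (hD : ((P ^ 2 + 4 : ℤ) : ZMod l) ≠ 0) (hN : 2 ∣ N) (he : 2 ^ e ∣ N)
    (h1 : (l : ℤ) ∣ lucasU P (-1) N) (h2 : ¬ (l : ℤ) ∣ lucasU P (-1) (N / 2)) :
    (legendreSym l (P ^ 2 + 4) = 1 ∧ 2 ^ e ∣ l - 1) ∨
      (legendreSym l (P ^ 2 + 4) = -1 ∧ 2 ^ e ∣ l + 1) := by
  have hlp : l.Prime := Fact.out
  have : CharP K l := charP_of_injective_algebraMap (algebraMap (ZMod l) K).injective l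
  have cast_eq : ∀ a : ℤ, algebraMap (ZMod l) K (a : ZMod l) = (a : K) := fun a => map_intCast _ a
  have two_ne : (2 : K) ≠ 0 := by
    intro h
    have : ((2 : ℕ) : K) = 0 := by exact_mod_cast h
    rw [CharP.cast_eq_zero_iff K l] at this
    exact hl ((Nat.prime_dvd_prime_iff_eq hlp Nat.prime_two).mp this)
  obtain ⟨δ, hδ⟩ := IsAlgClosed.exists_pow_nat_eq ((P ^ 2 + 4 : ℤ) : K) (n := 2) two_pos
  have hΔ : ((P ^ 2 + 4 : ℤ) : K) ≠ 0 := by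
    rw [← cast_eq]
    exact fun h => hD ((map_eq_zero _).mp h)
  have δ_ne : δ ≠ 0 := by
    rintro rfl
    exact hΔ (by rw [← hδ]; simp)
  have hδ' : δ ^ 2 = (P : K) ^ 2 + 4 := by rw [hδ]; push_cast; ring
  set α : K := (P + δ) / 2 with hα
  set β : K := (P - δ) / 2 with hβ
  have hsub : α - β = δ := by rw [hα, hβ]; field_simp; ring
  have hadd : α + β = (P : K) := by rw [hα, hβ]; field_simp; ring
  have hmul : α * β = ((-1 : ℤ) : K) := by
    rw [hα, hβ]; field_simp; push_cast; linear_combination -hδ'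
  have hβ0 : β ≠ 0 := by
    intro h
    rw [h] at hmul
    simp at hmul
  have hα0 : α ≠ 0 := by
    intro h
    rw [h] at hmul
    simp at hmul
  have key : ∀ m, (l : ℤ) ∣ lucasU P (-1) m ↔ orderOf (α / β) ∣ m := by
    intro m
    rw [orderOf_dvd_iff_pow_eq_one, div_pow, div_eq_one_iff_eq (pow_ne_zero _ hβ0),
      ← sub_eq_zero, ← lucasU_closed_form α β P (-1) hadd hmul, hsub, mul_eq_zero,
      ← CharP.intCast_eq_zero_iff K l]
    simp [δ_ne]
  rw [key] at h1 h2
  have hdvd := two_pow_dvd_of_dvd_of_not_dvd_half h1 hN h2 he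
  have hfrobδ : δ ^ l = δ * (legendreSym l (P ^ 2 + 4) : K) := by
    have h := congrArg (algebraMap (ZMod l) K) (legendreSym.eq_pow l (P ^ 2 + 4))
    rw [map_pow, cast_eq, cast_eq] at h
    rw [h, ← hδ, ← pow_mul, ← pow_succ']
    congr 1
    have := hlp.eq_two_or_odd
    omega
  have hP : frobenius K l (P : K) = P := map_intCast _ _
  have h2' : frobenius K l 2 = 2 := map_ofNat _ 2
  have hfα : α ^ l = (P + δ ^ l) / 2 := by
    rw [← frobenius_def, hα, map_div₀, map_add, hP, h2', frobenius_def]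
  have hfβ : β ^ l = (P - δ ^ l) / 2 := by
    rw [← frobenius_def, hβ, map_div₀, map_sub, hP, h2', frobenius_def]
  rcases legendreSym.eq_one_or_neg_one l hD with h | h
  · refine Or.inl ⟨h, hdvd.trans ?_⟩
    rw [h] at hfrobδ
    have hα1 : α ^ (l - 1) = 1 := by
      apply mul_left_cancel₀ hα0
      rw [← pow_succ', Nat.sub_add_cancel hlp.one_le, hfα, hfrobδ]
      simp [hα]
    have hβ1 : β ^ (l - 1) = 1 := by
      apply mul_left_cancel₀ hβ0
      rw [← pow_succ', Nat.sub_add_cancel hlp.one_le, hfβ, hfrobδ]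
      simp [hβ]
    rw [orderOf_dvd_iff_pow_eq_one, div_pow, hα1, hβ1, div_one]
  · refine Or.inr ⟨h, hdvd.trans ?_⟩
    rw [h] at hfrobδ
    have hα1 : α ^ l = β := by rw [hfα, hfrobδ, hβ]; push_cast; ring
    have hβ1 : β ^ l = α := by rw [hfβ, hfrobδ, hα]; push_cast; ring
    rw [orderOf_dvd_iff_pow_eq_one, div_pow, pow_succ, pow_succ, hα1, hβ1, mul_comm,
      div_self (mul_ne_zero hα0 hβ0)]

/-- Every prime factor of a number satisfying the Lucas condition is `±1` modulo `2 ^ e`. -/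
theorem LucasCondition.prime_factor {n : ℕ} {P : ℤ} {e : ℕ} (h : LucasCondition n P e) {l : ℕ}
    (hl : l.Prime) (hln : l ∣ n) :
    (jacobiSym (P ^ 2 + 4) l = 1 ∧ 2 ^ e ∣ l - 1) ∨
      (jacobiSym (P ^ 2 + 4) l = -1 ∧ 2 ^ e ∣ l + 1) := by
  obtain ⟨hodd, hJ, he, hF, hU, hg⟩ := h
  have : Fact l.Prime := ⟨hl⟩
  have hl2 : l ≠ 2 := by
    rintro rfl
    exact (Nat.not_even_iff_odd.mpr hodd) (even_iff_two_dvd.mpr hln)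
  rw [← jacobiSym.legendreSym.to_jacobiSym]
  refine two_pow_dvd_of_lucasU (AlgebraicClosure (ZMod l)) hl2 (N := n + 1) ?_ ?_ hF ?_ ?_
  · intro h0
    rw [ZMod.intCast_zmod_eq_zero_iff_dvd] at h0 
    have hz : jacobiSym (P ^ 2 + 4) n = 0 := by
      rw [jacobiSym.eq_zero_iff]
      refine ⟨hodd.pos.ne', fun h1 => ?_⟩
      have := Int.dvd_coe_gcd h0 (Int.natCast_dvd_natCast.mpr hln)
      rw [h1] at this
      exact hl.one_lt.ne' (by exact_mod_cast Int.eq_one_of_dvd_one (by positivity) this)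
    rw [hz] at hJ
    exact absurd hJ (by norm_num)
  · exact even_iff_two_dvd.mp hodd.add_one
  · exact (Int.natCast_dvd_natCast.mpr hln).trans hU
  · intro h2
    have := Int.dvd_coe_gcd h2 (Int.natCast_dvd_natCast.mpr hln)
    rw [hg] at this
    exact hl.one_lt.ne' (by exact_mod_cast Int.eq_one_of_dvd_one (by positivity) this)

theorem LucasCondition.ne_one {n : ℕ} {P : ℤ} {e : ℕ} (h : LucasCondition n P e) : n ≠ 1 := by
  rintro rfl
  have := h.2.1
  rw [jacobiSym.one_right] at this
  norm_num at this

theorem LucasCondition.le_prime_factor {n : ℕ} {P : ℤ} {e : ℕ} (h : LucasCondition n P e) {l : ℕ}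
    (hl : l.Prime) (hln : l ∣ n) : 2 ^ e ≤ l + 1 := by
  have := hl.two_le
  rcases h.prime_factor hl hln with ⟨-, h1⟩ | ⟨-, h1⟩
  · have := Nat.le_of_dvd (by omega) h1
    omega
  · exact Nat.le_of_dvd (by omega) h1

theorem PassesSqrtTest.prime {n : ℕ} {P : ℤ} {e : ℕ} (h : PassesSqrtTest n P e) : n.Prime := by
  obtain ⟨h, hlt⟩ := h
  by_contra hn
  have hle := h.le_prime_factor (Nat.minFac_prime h.ne_one) (Nat.minFac_dvd n)
  have hsq : n.minFac ^ 2 ≤ n := Nat.minFac_sq_le_self h.1.pos hn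
  have h1 : (n.minFac : ℝ) ≤ Real.sqrt n := Real.le_sqrt_of_sq_le (by exact_mod_cast hsq)
  have h2 : (2 : ℝ) ^ e ≤ n.minFac + 1 := by exact_mod_cast hle
  linarith

/-- If `n + 1 = F * (r₁ * F + r₀)` and `n = (a * F + 1) * (b * F - 1)` is small, one of the two
quadratics attached to `r₀`, `r₁` has the positive root `a`. -/
theorem exists_root_of_factorization {F a b r₁ r₀ : ℤ} (ha : 0 < a) (hb : 0 < b) (hF : 2 < F)
    (hr₀ : 0 ≤ r₀) (hr₀' : r₀ < F) (hr₁' : r₁ < F)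
    (hlt : (a * F + 1) * (b * F - 1) < (F - 1) ^ 3)
    (hn : (a * F + 1) * (b * F - 1) + 1 = F * (r₁ * F + r₀)) :
    a ^ 2 + r₀ * a - r₁ = 0 ∨ a ^ 2 + (r₀ - F) * a - r₁ - 1 = 0 := by
  have hR : a * b * F + (b - a) = r₁ * F + r₀ := by
    have h : F * (a * b * F + (b - a)) = F * (r₁ * F + r₀) := by rw [← hn]; ring
    exact mul_left_cancel₀ (by omega) h
  have hab : 0 < a * b := mul_pos ha hb
  have hab' : a * b < F - 1 := by
    have h1 : a * b * F * (F - 1) < (F - 1) ^ 2 * (F - 1) := by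
      nlinarith [mul_nonneg (mul_pos ha (show 0 < F by omega)).le (show 0 ≤ b - 1 by omega),
        mul_pos hb (show 0 < F by omega)]
    have h2 : a * b * F < (F - 1) ^ 2 := lt_of_mul_lt_mul_right h1 (by omega)
    by_contra h
    push Not at h
    nlinarith
  have hba : b - a < F ∧ a - b < F := by
    constructor <;> nlinarith
  obtain ⟨h1, h2⟩ := hba
  rcases le_or_gt a b with hle | hlt'
  · left
    have : r₁ = a * b := by
      by_contra hne
      rcases lt_or_gt_of_ne hne with h | h <;> nlinarith
    have : r₀ = b - a := by rw [this] at hR; linarith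
    subst this
    rw [‹r₁ = a * b›]
    ring
  · right
    have : r₁ = a * b - 1 := by
      by_contra hne
      rcases lt_or_gt_of_ne hne with h | h <;> nlinarith
    have : r₀ = F + b - a := by rw [this] at hR; linarith
    subst this
    rw [‹r₁ = a * b - 1›]
    ring

theorem PassesCbrtTest.prime {n : ℕ} {P : ℤ} {e : ℕ} (h : PassesCbrtTest n P e) : n.Prime := by
  obtain ⟨h, hlt, R, r₁, r₀, hR, hR', hr₁, hr₀, hroot⟩ := h
  have hF4 : 4 ≤ 2 ^ e := by
    calc 4 = 2 ^ 2 := rfl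
      _ ≤ 2 ^ e := Nat.pow_le_pow_right two_pos h.2.2.1
  have hcube : (n : ℤ) < (2 ^ e - 1) ^ 3 := by
    have h1 : (n : ℝ) ^ (1 / 3 : ℝ) < 2 ^ e - 1 := by linarith
    have h2 : ((n : ℝ) ^ (1 / 3 : ℝ)) ^ 3 = n := by
      rw [← Real.rpow_natCast, ← Real.rpow_mul (by positivity)]
      norm_num
    have h3 := pow_lt_pow_left₀ h1 (by positivity) (n := 3) (by norm_num)
    rw [h2] at h3
    exact_mod_cast h3
  by_contra hn
  have hn0 := h.1.pos
  have hlp := Nat.minFac_prime h.ne_one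
  obtain ⟨m, hm⟩ := Nat.minFac_dvd n
  set l := n.minFac with hldef
  have hm1 : m ≠ 1 := by
    rintro rfl
    rw [mul_one] at hm
    exact hn (hm ▸ hlp)
  have hm0 : m ≠ 0 := by
    rintro rfl
    omega
  have hmn : m ∣ n := ⟨l, by rw [mul_comm]; exact hm⟩
  have hle1 := h.le_prime_factor hlp (Nat.minFac_dvd n)
  have hmp : m.Prime := by
    by_contra hmn'
    have h1 : m.minFac ^ 2 ≤ m := Nat.minFac_sq_le_self (Nat.pos_of_ne_zero hm0) hmn'
    have h2 := h.le_prime_factor (Nat.minFac_prime hm1) ((Nat.minFac_dvd m).trans hmn)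
    have h1' : ((2 : ℤ) ^ e - 1) ^ 2 ≤ m := by
      have h2' : (2 : ℤ) ^ e - 1 ≤ m.minFac := by
        have : (2 : ℤ) ^ e ≤ m.minFac + 1 := by exact_mod_cast h2
        linarith
      have : (4 : ℤ) ≤ 2 ^ e := by exact_mod_cast hF4
      calc ((2 : ℤ) ^ e - 1) ^ 2 ≤ (m.minFac : ℤ) ^ 2 := by gcongr; omega
        _ ≤ (m : ℤ) := by exact_mod_cast h1
    have hle1' : (2 : ℤ) ^ e - 1 ≤ l := by
      have : (2 : ℤ) ^ e ≤ l + 1 := by exact_mod_cast hle1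
      linarith
    have : ((2 : ℤ) ^ e - 1) ^ 3 ≤ n := by
      calc ((2 : ℤ) ^ e - 1) ^ 3 = ((2 : ℤ) ^ e - 1) * ((2 : ℤ) ^ e - 1) ^ 2 := by ring
        _ ≤ (l : ℤ) * m := by gcongr
        _ = (n : ℤ) := by rw [hm]; push_cast; ring
    linarith
  have hJ := h.2.1
  rw [hm, jacobiSym.mul_right' _ hlp.ne_zero hm0] at hJ
  have main : ∀ {x y : ℕ}, x.Prime → y.Prime → n = x * y → 2 ^ e ∣ x - 1 → 2 ^ e ∣ y + 1 →
      False := by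
    rintro x y hx hy hxy ⟨a, ha⟩ ⟨b, hb⟩
    have hx2 := hx.two_le
    have hx' : (x : ℤ) = a * 2 ^ e + 1 := by
      have : x = 2 ^ e * a + 1 := by omega
      rw [this]; push_cast; ring
    have hy' : (y : ℤ) = b * 2 ^ e - 1 := by
      have : (y : ℤ) + 1 = 2 ^ e * b := by exact_mod_cast hb
      linarith
    have ha0 : 0 < a := by
      rcases Nat.eq_zero_or_pos a with rfl | h
      · omega
      · exact h
    have hb0 : 0 < b := by
      rcases Nat.eq_zero_or_pos b with rfl | h
      · omega
      · exact h
    have hn' : ((a : ℤ) * 2 ^ e + 1) * (b * 2 ^ e - 1) = n := by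
      rw [← hx', ← hy', hxy]; push_cast; rfl
    have := exists_root_of_factorization (F := 2 ^ e) (a := a) (b := b) (r₁ := r₁) (r₀ := r₀)
      (by exact_mod_cast ha0) (by exact_mod_cast hb0)
      (by have : (4 : ℤ) ≤ 2 ^ e := by exact_mod_cast hF4
          linarith)
      (by positivity) (by exact_mod_cast hr₀) (by exact_mod_cast hr₁)
      (by rw [hn']; exact hcube) (by rw [hn']; rw [hR'] at hR; exact_mod_cast hR)
    obtain ⟨h1, h2⟩ := hroot a (by exact_mod_cast ha0)
    rcases this with h | h
    · exact h1 h
    · exact h2 h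
  rcases h.prime_factor hlp (Nat.minFac_dvd n) with ⟨j1, d1⟩ | ⟨j1, d1⟩ <;>
    rcases h.prime_factor hmp hmn with ⟨j2, d2⟩ | ⟨j2, d2⟩
  · rw [j1, j2] at hJ; norm_num at hJ
  · exact main hlp hmp hm d1 d2
  · exact main hmp hlp (by rw [mul_comm]; exact hm) d2 d1
  · rw [j1, j2] at hJ; norm_num at hJ

theorem LucasTest.Passes.prime {t : LucasTest} {n : ℕ} {P : ℤ} {e : ℕ} (h : t.Passes n P e) :
    n.Prime := by
  cases t
  · exact PassesSqrtTest.prime h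
  · exact PassesCbrtTest.prime h

open Finset in
theorem sum_divisors_two_pow_add_one (s : ℕ) : (∑ d ∈ (2 ^ s).divisors, d) + 1 = 2 ^ (s + 1) := by
  rw [Nat.sum_divisors_prime_pow Nat.prime_two]
  induction s + 1 with
  | zero => simp
  | succ t ih => rw [sum_range_succ, pow_succ]; omega

theorem Nat.Prime.sum_divisors_eq_add_one {p : ℕ} (hp : p.Prime) : ∑ d ∈ p.divisors, d = p + 1 := by
  rw [hp.sum_divisors]

open Finset in
/-- With `N = 2 ^ (k + 1) - 1`, let `p = N + a` and `q = N + b` be primes such that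
`a * b = 2 ^ (k + 2) * (2 ^ k - 1)`. Then the abundance of `2 ^ k * p * q` is `2 ^ (k + 1)`, which is
not a sum of distinct divisors, while all aliquot parts are deficient. -/
theorem primitiveWeird_two_pow_mul_mul {k p q a b : ℕ} (hp : p.Prime) (hq : q.Prime)
    (hpq : p ≠ q) (ha : 2 ≤ a) (hb : 2 ≤ b) (hpa : p + 1 = 2 ^ (k + 1) + a)
    (hqb : q + 1 = 2 ^ (k + 1) + b) (hab : a * b + 2 ^ (k + 2) = 2 ^ (k + 2) * 2 ^ k) :
    PrimitiveWeird (2 ^ k * p * q) := by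
  have hk1 : 2 ≤ 2 ^ (k + 1) := by
    rw [pow_succ]
    have := Nat.one_le_two_pow (n := k)
    omega
  have hp2 : p ≠ 2 := by omega
  have hq2 : q ≠ 2 := by omega
  have c2p : ∀ s, Nat.Coprime (2 ^ s) p := fun s =>
    ((Nat.coprime_primes Nat.prime_two hp).mpr hp2.symm).pow_left s
  have c2q : ∀ s, Nat.Coprime (2 ^ s) q := fun s =>
    ((Nat.coprime_primes Nat.prime_two hq).mpr hq2.symm).pow_left s
  have cpq : Nat.Coprime p q := (Nat.coprime_primes hp hq).mpr hpq
  have hn0 : 0 < 2 ^ k * p * q := by have := hp.pos; have := hq.pos; positivity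
  have hsum : ∀ s, ∑ d ∈ (2 ^ s * p * q).divisors, d =
      (∑ d ∈ (2 ^ s).divisors, d) * (p + 1) * (q + 1) := by
    intro s
    rw [Nat.Coprime.sum_divisors_mul (Nat.Coprime.mul_left (c2q s) cpq),
      Nat.Coprime.sum_divisors_mul (c2p s), hp.sum_divisors_eq_add_one, hq.sum_divisors_eq_add_one]
  have habund : ∑ d ∈ (2 ^ k * p * q).divisors, d = 2 * (2 ^ k * p * q) + 2 ^ (k + 1) := by
    rw [hsum]
    have h := sum_divisors_two_pow_add_one k
    generalize ∑ d ∈ (2 ^ k).divisors, d = S at h ⊢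
    zify at *
    have hS : (S : ℤ) = 2 * 2 ^ k - 1 := by rw [pow_succ] at h; linarith
    have hp' : (p : ℤ) = 2 * 2 ^ k + a - 1 := by rw [pow_succ] at hpa; linarith
    have hq' : (q : ℤ) = 2 * 2 ^ k + b - 1 := by rw [pow_succ] at hqb; linarith
    rw [hS, hp', hq']
    rw [pow_succ, pow_succ] at hab
    rw [pow_succ]
    linear_combination -hab
  refine ⟨⟨?_, ?_⟩, ?_⟩
  · rw [Nat.abundant_iff_sum_divisors, habund]
    omega
  · rintro ⟨-, s, hs, hsn⟩
    have h1 := sum_sdiff (f := fun i => i) hs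
    have h2 := Nat.sum_divisors_eq_sum_properDivisors_add_self (n := 2 ^ k * p * q)
    have h3 : ∑ i ∈ (2 ^ k * p * q).properDivisors \ s, i = 2 ^ (k + 1) := by
      rw [hsn] at h1
      omega
    have hsub : (2 ^ k * p * q).properDivisors \ s ⊆ (2 ^ k).divisors := by
      intro d hd
      have hle : d ≤ 2 ^ (k + 1) :=
        h3 ▸ single_le_sum (f := fun i => i) (fun _ _ => Nat.zero_le _) hd
      have hdn : d ∣ 2 ^ k * p * q := (Nat.mem_properDivisors.mp (mem_sdiff.mp hd).1).1
      have hd0 : 0 < d := Nat.pos_of_dvd_of_pos hdn hn0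
      have hdp : ¬ p ∣ d := fun h => by have := Nat.le_of_dvd hd0 h; omega
      have hdq : ¬ q ∣ d := fun h => by have := Nat.le_of_dvd hd0 h; omega
      rw [Nat.mem_divisors]
      refine ⟨?_, by positivity⟩
      have := (hq.coprime_iff_not_dvd.mpr hdq).symm.dvd_of_dvd_mul_right hdn
      exact (hp.coprime_iff_not_dvd.mpr hdp).symm.dvd_of_dvd_mul_right this
    have h4 : ∑ i ∈ (2 ^ k * p * q).properDivisors \ s, i ≤ ∑ i ∈ (2 ^ k).divisors, i :=
      sum_le_sum_of_subset hsub
    have h5 := sum_divisors_two_pow_add_one k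
    omega
  · rintro d hd ⟨hab', -⟩
    rw [Nat.abundant_iff_sum_divisors] at hab'
    rw [Nat.mem_properDivisors] at hd
    obtain ⟨hdn, hlt⟩ := hd
    obtain ⟨d', z, hd', hz, rfl⟩ := exists_dvd_and_dvd_of_dvd_mul hdn
    obtain ⟨x, y, hx, hy, rfl⟩ := exists_dvd_and_dvd_of_dvd_mul hd'
    obtain ⟨s, hs, rfl⟩ := (Nat.dvd_prime_pow Nat.prime_two).mp hx
    have hS := sum_divisors_two_pow_add_one s
    have hsk : 2 ^ (s + 1) ≤ 2 ^ (k + 1) := Nat.pow_le_pow_right two_pos (by omega)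
    have deficient_mul : ∀ {r : ℕ}, r.Prime → Nat.Coprime (2 ^ s) r → 2 ^ (k + 1) < r + 1 →
        ¬ 2 * (2 ^ s * r) < ∑ i ∈ (2 ^ s * r).divisors, i := by
      intro r hr hc hlt
      rw [Nat.Coprime.sum_divisors_mul hc, hr.sum_divisors_eq_add_one, not_lt]
      generalize ∑ i ∈ (2 ^ s).divisors, i = S at hS
      rw [pow_succ] at hS hsk
      nlinarith
    rcases (Nat.dvd_prime hp).mp hy with rfl | rfl <;> rcases (Nat.dvd_prime hq).mp hz with rfl | rfl
    · rw [mul_one, mul_one] at hab'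
      rw [pow_succ] at hS
      omega
    · rw [mul_one] at hab'
      exact deficient_mul hq (c2q s) (by omega) hab'
    · rw [mul_one] at hab'
      exact deficient_mul hp (c2p s) (by omega) hab'
    · have hsk' : s < k := by
        by_contra h
        rw [show s = k by omega] at hlt
        omega
      rw [hsum] at hab'
      have h2 : 2 ^ (s + 1) ≤ 2 ^ k := Nat.pow_le_pow_right two_pos hsk'
      generalize ∑ i ∈ (2 ^ s).divisors, i = S at hS hab'
      rw [pow_succ] at hpa hqb
      have e1 : S + 1 = 2 * 2 ^ s := by rw [hS, pow_succ, mul_comm]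
      have hSk : S + 1 ≤ 2 ^ k := hS ▸ h2
      have : S * (y + 1) * (z + 1) ≤ (S + 1) * y * z := by
        obtain ⟨y', rfl⟩ : ∃ y', y = S + y' := ⟨y - S, by omega⟩
        obtain ⟨z', rfl⟩ : ∃ z', z = S + z' := ⟨z - S, by omega⟩
        have hy' : S + 1 ≤ y' := by omega
        have hz' : S + 1 ≤ z' := by omega
        nlinarith [Nat.mul_le_mul hy' hz']
      have e2 : 2 * (2 ^ s * y * z) = (S + 1) * y * z := by rw [e1]; ring
      omega

/-- `force x f` is `f x`, arranged so that evaluating it computes `x` first. -/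
def force {α : Type} (x : ℕ) (f : ℕ → α) : α :=
  match x with
  | 0 => f 0
  | Nat.succ m => f (Nat.succ m)

@[simp] theorem force_eq {α : Type} (x : ℕ) (f : ℕ → α) : force x f = f x := by
  cases x <;> rfl

/-- The number of binary digits of `x`, provided that `x < 2 ^ 2 ^ i`, found by bisection. -/
def bitLength : ℕ → ℕ → ℕ
  | 0, _ => 1
  | i + 1, x => force (Nat.shiftRight x (2 ^ i)) fun y =>
    match y with
    | 0 => bitLength i x
    | Nat.succ _ => force (bitLength i y) fun l => 2 ^ i + l

/-- The part of a binary ladder modulo `n` that reads the lowest bits of `R`; the pair of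
accumulators goes from `(W m, W (m + 1))` to `(W (2 * m + b), W (2 * m + b + 1))`, for a sequence
with `W (2 * m) = W m ^ 2 + s` and `W (2 * m + 1) = W m * W (m + 1) + c`. -/
def lucasLadder (n s c R : ℕ) : ℕ → ℕ → ℕ → ℕ
  | 0, x, _ => x
  | i + 1, x, y =>
    force (Nat.mod (Nat.add (Nat.mul x y) c) n) fun z =>
      match Nat.mod (Nat.shiftRight R i) 2 with
      | 0 => force (Nat.mod (Nat.add (Nat.mul x x) s) n) fun w => lucasLadder n s c R i w z
      | Nat.succ _ => force (Nat.mod (Nat.add (Nat.mul y y) s) n) fun w => lucasLadder n s c R i z w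

/-- Iterates `x ↦ x ^ 2 + s` modulo `n`. -/
def iterateSqAdd (n s : ℕ) : ℕ → ℕ → ℕ
  | 0, x => x
  | i + 1, x => force (Nat.mod (Nat.add (Nat.mul x x) s) n) fun w => iterateSqAdd n s i w

theorem lucasLadder_eq {n s c : ℕ} (W : ℕ → ZMod n) (hs : ∀ m, W (2 * m) = W m ^ 2 + s)
    (hc : ∀ m, W (2 * m + 1) = W m * W (m + 1) + c) (R i x y : ℕ) (hx : (x : ZMod n) = W (R >>> i))
    (hy : (y : ZMod n) = W (R >>> i + 1)) : (lucasLadder n s c R i x y : ZMod n) = W R := by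
  induction i generalizing x y with
  | zero => simpa [lucasLadder] using hx
  | succ i ih =>
    have hR : R >>> i = 2 * (R >>> (i + 1)) + R >>> i % 2 := by
      rw [Nat.shiftRight_succ]; omega
    have hz : (((x * y + c) % n : ℕ) : ZMod n) = W (2 * (R >>> (i + 1)) + 1) := by
      rw [hc, ← hx, ← hy]; simp
    simp only [lucasLadder, force_eq]
    split
    · rename_i h
      change R >>> i % 2 = 0 at h
      rw [h] at hR
      refine ih _ _ ?_ ?_
      · change (((x * x + s) % n : ℕ) : ZMod n) = _
        rw [hR, add_zero, hs, ← hx]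
        simp [sq]
      · rw [hR]
        exact hz
    · rename_i b h
      change R >>> i % 2 = b + 1 at h
      have h1 : R >>> i % 2 = 1 := by omega
      rw [h1] at hR
      refine ih _ _ ?_ ?_
      · rw [hR]
        exact hz
      · change (((y * y + s) % n : ℕ) : ZMod n) = _
        rw [hR, show 2 * (R >>> (i + 1)) + 1 + 1 = 2 * (R >>> (i + 1) + 1) by ring, hs, ← hy]
        simp [sq]

theorem iterateSqAdd_eq {n s : ℕ} (W : ℕ → ZMod n) (hs : ∀ m, W (2 * m) = W m ^ 2 + s)
    (i x m : ℕ) (hx : (x : ZMod n) = W m) :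
    (iterateSqAdd n s i x : ZMod n) = W (2 ^ i * m) := by
  induction i generalizing x m with
  | zero => simpa [iterateSqAdd] using hx
  | succ i ih =>
    simp only [iterateSqAdd, force_eq]
    rw [pow_succ, mul_assoc]
    refine ih _ _ ?_
    change (((x * x + s) % n : ℕ) : ZMod n) = _
    rw [hs, ← hx]
    simp [sq]

/-- The companion Lucas numbers `V (2 * m)` for `Q = -1`. -/
def evenLucasV (P : ℤ) (m : ℕ) : ℤ :=
  2 * lucasU P (-1) (2 * m + 1) - P * lucasU P (-1) (2 * m)

section
variable (P : ℤ)

theorem exists_lucas_roots : ∃ α β : ℂ, α + β = P ∧ α * β = -1 ∧ (α - β) ^ 2 = (P : ℂ) ^ 2 + 4 ∧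
    α - β ≠ 0 := by
  obtain ⟨δ, hδ⟩ := IsAlgClosed.exists_pow_nat_eq ((P : ℂ) ^ 2 + 4) (n := 2) two_pos
  refine ⟨(P + δ) / 2, (P - δ) / 2, by ring, by linear_combination -hδ / 4,
    by linear_combination hδ, fun h => ?_⟩
  have h0 : δ = 0 := by linear_combination h
  rw [h0] at hδ
  have : P ^ 2 + 4 = 0 := by
    have : ((P ^ 2 + 4 : ℤ) : ℂ) = 0 := by push_cast; rw [← hδ]; simp
    exact_mod_cast this
  nlinarith [sq_nonneg P]

theorem evenLucasV_closed_form {α β : ℂ} (hP : α + β = P) (hQ : α * β = -1) (h : α - β ≠ 0)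
    (m : ℕ) : (evenLucasV P m : ℂ) = (α ^ m) ^ 2 + (β ^ m) ^ 2 := by
  have hQ' : α * β = ((-1 : ℤ) : ℂ) := by simpa using hQ
  have h1 := lucasU_closed_form α β P (-1) hP hQ' (2 * m)
  have h2 := lucasU_closed_form α β P (-1) hP hQ' (2 * m + 1)
  apply mul_left_cancel₀ h
  rw [evenLucasV]
  push_cast
  rw [← hP]
  linear_combination 2 * h2 - (α + β) * h1

theorem evenLucasV_zero : evenLucasV P 0 = 2 := by simp [evenLucasV, lucasU]

theorem evenLucasV_one : evenLucasV P 1 = P ^ 2 + 2 := by simp [evenLucasV, lucasU]; ring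

theorem evenLucasV_two_mul (m : ℕ) : evenLucasV P (2 * m) = evenLucasV P m ^ 2 - 2 := by
  obtain ⟨α, β, hP, hQ, -, h⟩ := exists_lucas_roots P
  have hm : (α ^ m * β ^ m) ^ 2 = 1 := by rw [← mul_pow, hQ, ← pow_mul, mul_comm, pow_mul]; simp
  rw [← Int.cast_inj (α := ℂ)]
  push_cast
  rw [evenLucasV_closed_form P hP hQ h, evenLucasV_closed_form P hP hQ h]
  linear_combination -2 * hm

theorem evenLucasV_two_mul_add_one (m : ℕ) :
    evenLucasV P (2 * m + 1) = evenLucasV P m * evenLucasV P (m + 1) - (P ^ 2 + 2) := by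
  obtain ⟨α, β, hP, hQ, -, h⟩ := exists_lucas_roots P
  have hm : (α ^ m * β ^ m) ^ 2 = 1 := by rw [← mul_pow, hQ, ← pow_mul, mul_comm, pow_mul]; simp
  rw [← Int.cast_inj (α := ℂ)]
  push_cast
  rw [evenLucasV_closed_form P hP hQ h, evenLucasV_closed_form P hP hQ h,
    evenLucasV_closed_form P hP hQ h, ← hP]
  linear_combination -(α ^ 2 + β ^ 2) * hm + 2 * hQ

theorem lucasU_four_mul (m : ℕ) :
    lucasU P (-1) (4 * m) = lucasU P (-1) (2 * m) * evenLucasV P m := by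
  obtain ⟨α, β, hP, hQ, -, h⟩ := exists_lucas_roots P
  have hQ' : α * β = ((-1 : ℤ) : ℂ) := by simpa using hQ
  have h1 := lucasU_closed_form α β P (-1) hP hQ' (2 * m)
  have h2 := lucasU_closed_form α β P (-1) hP hQ' (4 * m)
  rw [← Int.cast_inj (α := ℂ)]
  push_cast
  apply mul_left_cancel₀ h
  rw [h2, ← mul_assoc, h1, evenLucasV_closed_form P hP hQ h]
  ring

theorem evenLucasV_sq (m : ℕ) :
    evenLucasV P m ^ 2 = (P ^ 2 + 4) * lucasU P (-1) (2 * m) ^ 2 + 4 := by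
  obtain ⟨α, β, hP, hQ, hD, h⟩ := exists_lucas_roots P
  have hm : (α ^ m * β ^ m) ^ 2 = 1 := by rw [← mul_pow, hQ, ← pow_mul, mul_comm, pow_mul]; simp
  have hQ' : α * β = ((-1 : ℤ) : ℂ) := by simpa using hQ
  have h1 := lucasU_closed_form α β P (-1) hP hQ' (2 * m)
  rw [← Int.cast_inj (α := ℂ)]
  push_cast
  rw [← hD, ← mul_pow, h1, evenLucasV_closed_form P hP hQ h]
  linear_combination 4 * hm

end

/-- The divisibility part of the Lucas condition follows from `n ∣ V ((n + 1) / 2)`. -/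
theorem lucas_dvd_and_gcd_eq_one {n e R : ℕ} {P : ℤ} (hodd : Odd n) (he : 1 < e)
    (hR : n + 1 = 2 ^ e * R) (h : (n : ℤ) ∣ evenLucasV P (2 ^ (e - 2) * R)) :
    (n : ℤ) ∣ lucasU P (-1) (n + 1) ∧ Int.gcd (lucasU P (-1) ((n + 1) / 2)) (n : ℤ) = 1 := by
  obtain ⟨f, rfl⟩ : ∃ f, e = f + 2 := ⟨e - 2, by omega⟩
  rw [Nat.add_sub_cancel] at h
  have h4 : n + 1 = 4 * (2 ^ f * R) := by rw [hR]; ring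
  rw [h4, show 4 * (2 ^ f * R) / 2 = 2 * (2 ^ f * R) by omega]
  refine ⟨by rw [lucasU_four_mul]; exact h.mul_left _, ?_⟩
  rw [Int.gcd_eq_natAbs, Int.natAbs_natCast]
  refine Nat.Coprime.symm (Nat.coprime_of_dvd fun l hl hln hlU => ?_)
  have h1 : (l : ℤ) ∣ lucasU P (-1) (2 * (2 ^ f * R)) := Int.natCast_dvd.mpr hlU
  have h2 : (l : ℤ) ∣ evenLucasV P (2 ^ f * R) := (Int.natCast_dvd_natCast.mpr hln).trans h
  have h3 : (l : ℤ) ∣ 4 := by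
    have := evenLucasV_sq P (2 ^ f * R)
    rw [← sub_eq_iff_eq_add'] at this
    rw [← this]
    exact dvd_sub (dvd_pow h2 two_ne_zero) ((dvd_pow h1 two_ne_zero).mul_left _)
  have h5 : l ∣ 2 ^ 2 := by exact_mod_cast h3
  have h6 := (Nat.prime_dvd_prime_iff_eq hl Nat.prime_two).mp (hl.dvd_of_dvd_pow h5)
  rw [h6] at hln
  exact (Nat.not_even_iff_odd.mpr hodd) (even_iff_two_dvd.mpr hln)

/-- Small primes congruent to `1` modulo `4`. -/
def smallPrimes : List ℕ := [5, 13, 17, 29, 37, 41, 53, 173, 229, 293]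

theorem prime_of_mem_smallPrimes {D : ℕ} (h : D ∈ smallPrimes) : D.Prime ∧ D % 4 = 1 := by
  simp only [smallPrimes, List.mem_cons, List.not_mem_nil, or_false] at h
  rcases h with rfl | rfl | rfl | rfl | rfl | rfl | rfl | rfl | rfl | rfl <;> norm_num

theorem jacobiSym_eq_neg_one {n m g D : ℕ} (hn : n % 8 = 7) (hm : m = g * D) (hg : g ∣ 8)
    (hD : D.Prime) (hD4 : D % 4 = 1) (h : ((n % D) ^ (D / 2) + 1) % D = 0) :
    jacobiSym m n = -1 := by
  have hodd : Odd n := Nat.odd_iff.mpr (by omega)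
  have h2 : jacobiSym 2 n = 1 := by
    rw [jacobiSym.at_two hodd, ZMod.χ₈_nat_eq_if_mod_eight, hn]
    simp [show n % 2 ≠ 0 by omega]
  have hgJ : jacobiSym g n = 1 := by
    obtain ⟨t, -, rfl⟩ := (Nat.dvd_prime_pow Nat.prime_two (m := 3)).mp hg
    push_cast
    rw [jacobiSym.pow_left, h2, one_pow]
  have := Fact.mk hD
  rw [hm, Nat.cast_mul, jacobiSym.mul_left, hgJ, one_mul,
    jacobiSym.quadratic_reciprocity_one_mod_four hD4 hodd, ← jacobiSym.legendreSym.to_jacobiSym]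
  have h' : ((n : ℤ) : ZMod D) ^ (D / 2) = -1 := by
    have h0 : (((n % D) ^ (D / 2) + 1 : ℕ) : ZMod D) = 0 :=
      (ZMod.natCast_eq_zero_iff _ _).mpr (Nat.dvd_of_mod_eq_zero h)
    push_cast at h0
    rw [ZMod.natCast_mod] at h0
    rw [Int.cast_natCast]
    exact eq_neg_of_add_eq_zero_left h0
  have hne : ((n : ℤ) : ZMod D) ≠ 0 := by
    intro h0
    rw [h0, zero_pow (by have := hD.two_le; omega)] at h'
    exact one_ne_zero (neg_eq_zero.mp h'.symm)
  rcases legendreSym.eq_one_or_neg_one D hne with h1 | h1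
  · have := legendreSym.eq_pow D n
    rw [h1, h'] at this
    have hD2 : D ≠ 2 := by omega
    have := Fact.mk (show 2 < D by have := hD.two_le; omega)
    exact absurd (by simpa using ‹((1 : ℤ) : ZMod D) = -1›) (ZMod.neg_one_ne_one (n := D)).symm
  · exact h1

/-- A sufficient criterion for the Lucas condition, for efficient evaluation. -/
def lucasCertificate (n P e : ℕ) : Bool :=
  decide (1 < e) && decide ((n + 1) % 2 ^ e = 0) && decide (n % 8 = 7) && decide (P * P + 2 ≤ n) &&
  (force ((P * P + 4) / Nat.gcd (P * P + 4) 8) fun D =>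
    decide (D ∈ smallPrimes) && decide (((n % D) ^ (D / 2) + 1) % D = 0)) &&
  force (n - 2) fun s =>
  force (n - (P * P + 2)) fun c =>
  force ((n + 1) / 2 ^ e) fun R =>
  force (bitLength 12 R) fun l => decide (R < 2 ^ l) &&
  force (lucasLadder n s c R l 2 (P * P + 2)) fun x =>
  decide (iterateSqAdd n s (e - 2) x % n = 0)

theorem lucasCondition_of_certificate {n P e : ℕ} (h : lucasCertificate n P e = true) :
    LucasCondition n P e := by
  simp only [lucasCertificate, force_eq, Bool.and_eq_true, decide_eq_true_eq] at h
  obtain ⟨⟨⟨⟨⟨he, hF⟩, h8⟩, hP⟩, hD, hJ⟩, hl, hW⟩ := h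
  have hodd : Odd n := Nat.odd_iff.mpr (by omega)
  have hR : n + 1 = 2 ^ e * ((n + 1) / 2 ^ e) :=
    (Nat.mul_div_cancel' (Nat.dvd_of_mod_eq_zero hF)).symm
  obtain ⟨hDp, hD4⟩ := prime_of_mem_smallPrimes hD
  have hjac := jacobiSym_eq_neg_one h8
    (Nat.mul_div_cancel' (Nat.gcd_dvd_left (P * P + 4) 8)).symm (Nat.gcd_dvd_right _ _) hDp hD4 hJ
  refine ⟨hodd, ?_, he, Nat.dvd_of_mod_eq_zero hF, ?_⟩
  · rw [← hjac]; push_cast; rw [sq]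
  · refine lucas_dvd_and_gcd_eq_one hodd he hR ?_
    generalize (n + 1) / 2 ^ e = R at hW hl ⊢
    generalize bitLength 12 R = l at hW hl
    let W : ℕ → ZMod n := fun m => ((evenLucasV P m : ℤ) : ZMod n)
    have hs : ∀ m, W (2 * m) = W m ^ 2 + (n - 2 : ℕ) := by
      intro m
      simp only [W]
      rw [evenLucasV_two_mul, Nat.cast_sub (by omega)]
      push_cast
      simp [sub_eq_add_neg]
    have hc : ∀ m, W (2 * m + 1) = W m * W (m + 1) + (n - (P * P + 2) : ℕ) := by
      intro m
      simp only [W]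
      rw [evenLucasV_two_mul_add_one, Nat.cast_sub hP]
      push_cast
      rw [CharP.cast_eq_zero (ZMod n) n]
      ring
    have h0 : R >>> l = 0 := by
      rw [Nat.shiftRight_eq_div_pow]
      exact Nat.div_eq_of_lt hl
    have h1 := lucasLadder_eq W hs hc R l 2 (P * P + 2)
      (by rw [h0]; simp [W, evenLucasV_zero])
      (by rw [h0]; simp [W, evenLucasV_one, sq])
    have h2 := iterateSqAdd_eq W hs (e - 2) _ R h1
    rw [(ZMod.natCast_eq_zero_iff _ _).mpr (Nat.dvd_of_mod_eq_zero hW)] at h2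
    exact (ZMod.intCast_zmod_eq_zero_iff_dvd _ _).mp h2.symm

/-- Newton's iteration for the integral square root. -/
def newtonSqrt (D : ℕ) : ℕ → ℕ → ℕ
  | 0, x => x
  | i + 1, x => force ((x + D / x) / 2) fun y => bif Nat.ble x y then x else newtonSqrt D i y

/-- Certifies that `D` is not a perfect square. -/
def isBetweenSquares (D : ℕ) : Bool :=
  force D fun D => force (newtonSqrt D 20 (2 ^ (bitLength 12 D / 2 + 1))) fun s =>
    decide (s * s < D) && decide (D < (s + 1) * (s + 1))

theorem ne_sq_of_isBetweenSquares {D : ℕ} (h : isBetweenSquares D = true) (x : ℤ) :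
    x ^ 2 ≠ D := by
  simp only [isBetweenSquares, force_eq, Bool.and_eq_true, decide_eq_true_eq] at h
  obtain ⟨h1, h2⟩ := h
  intro hx
  have hx' : x.natAbs * x.natAbs = D := by
    rw [← Int.natCast_inj]; push_cast; rw [← hx, abs_mul_abs_self, sq]
  rw [← hx'] at h1 h2
  have h3 := lt_of_mul_self_lt_mul_self₀ (Nat.zero_le _) h1
  have h4 := lt_of_mul_self_lt_mul_self₀ (Nat.zero_le _) h2
  omega

/-- The numerical conditions of the two tests, for efficient evaluation. -/
def LucasTest.certificate (n e : ℕ) : LucasTest → Bool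
  | .sqrtBound => decide (n < (2 ^ e - 1) ^ 2)
  | .cbrtBound => decide (n < (2 ^ e - 1) ^ 3) &&
    force (2 ^ e) fun F => force ((n + 1) / F) fun R => force (R / F) fun r₁ =>
    force (R % F) fun r₀ =>
      decide (r₁ < F) && isBetweenSquares (r₀ ^ 2 + 4 * r₁) &&
      isBetweenSquares ((F - r₀) ^ 2 + 4 * (r₁ + 1))

theorem LucasTest.passes_of_certificate {t : LucasTest} {n P e : ℕ}
    (hL : lucasCertificate n P e = true) (h : t.certificate n e = true) : t.Passes n P e := by
  have hC := lucasCondition_of_certificate hL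
  have hF : 1 ≤ 2 ^ e := Nat.one_le_two_pow
  cases t with
  | sqrtBound =>
    refine ⟨hC, ?_⟩
    simp only [LucasTest.certificate, decide_eq_true_eq] at h
    have h' : (n : ℝ) < ((2 ^ e - 1 : ℕ) : ℝ) ^ 2 := by exact_mod_cast h
    have := (Real.sqrt_lt' (y := ((2 ^ e - 1 : ℕ) : ℝ)) (x := n) ?_).mpr h'
    · rw [Nat.cast_sub hF] at this
      push_cast at this
      linarith
    · rcases Nat.eq_zero_or_pos (2 ^ e - 1) with h0 | h0
      · rw [h0] at h
        simp at h
      · exact_mod_cast h0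
  | cbrtBound =>
    simp only [LucasTest.certificate, force_eq, Bool.and_eq_true, decide_eq_true_eq] at h
    obtain ⟨hlt, ⟨hr₁, hsq₁⟩, hsq₂⟩ := h
    refine ⟨hC, ?_, (n + 1) / 2 ^ e, (n + 1) / 2 ^ e / 2 ^ e, (n + 1) / 2 ^ e % 2 ^ e,
      (Nat.mul_div_cancel' hC.2.2.2.1).symm, (Nat.div_add_mod' _ _).symm, hr₁,
      Nat.mod_lt _ hF, fun x _ => ⟨fun hx => ?_, fun hx => ?_⟩⟩
    · have h' : (n : ℝ) < ((2 ^ e - 1 : ℕ) : ℝ) ^ 3 := by exact_mod_cast hlt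
      have h1 := Real.rpow_lt_rpow (by positivity) h' (z := 1 / 3) (by norm_num)
      rw [← Real.rpow_natCast, ← Real.rpow_mul (by positivity)] at h1
      norm_num [Nat.cast_sub hF] at h1
      linarith
    · refine ne_sq_of_isBetweenSquares hsq₁ (2 * x + ((n + 1) / 2 ^ e % 2 ^ e : ℕ)) ?_
      generalize (n + 1) / 2 ^ e % 2 ^ e = r₀ at *
      generalize (n + 1) / 2 ^ e / 2 ^ e = r₁ at *
      push_cast
      linear_combination 4 * hx
    · refine ne_sq_of_isBetweenSquares hsq₂ (2 * x + (((n + 1) / 2 ^ e % 2 ^ e : ℕ) - 2 ^ e)) ?_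
      have hr₀ := (Nat.mod_lt ((n + 1) / 2 ^ e) hF).le
      generalize (n + 1) / 2 ^ e % 2 ^ e = r₀ at *
      generalize (n + 1) / 2 ^ e / 2 ^ e = r₁ at *
      push_cast [Nat.cast_sub hr₀]
      linear_combination 4 * hx

/-- The value at `x` of the cyclotomic polynomial `Φ_d` for `d ∣ 24`, in `ℕ`. -/
def cyclotomicNat (x : ℕ) : ℕ → ℕ
  | 1 => x - 1
  | 2 => x + 1
  | 3 => x ^ 2 + x + 1
  | 4 => x ^ 2 + 1
  | 6 => x ^ 2 - x + 1
  | 8 => x ^ 4 + 1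
  | 12 => x ^ 4 - x ^ 2 + 1
  | 24 => x ^ 8 - x ^ 4 + 1
  | _ => 0

theorem divisors_twentyFour : Nat.divisors 24 = {1, 2, 3, 4, 6, 8, 12, 24} := by decide +kernel

open Polynomial in
theorem eval_cyclotomic_of_dvd_twentyFour {d x : ℕ} (hd : d ∈ Nat.divisors 24) (hx : 0 < x) :
    (cyclotomic d ℤ).eval (x : ℤ) = cyclotomicNat x d := by
  have h4 : cyclotomic 4 ℤ = X ^ 2 + 1 := by
    simpa using (cyclotomic_expand_eq_cyclotomic Nat.prime_two (n := 2) (by norm_num) ℤ).symm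
  have h8 : cyclotomic 8 ℤ = X ^ 4 + 1 := by
    have := (cyclotomic_expand_eq_cyclotomic Nat.prime_two (n := 4) (by norm_num) ℤ).symm
    rw [h4] at this
    simpa [← pow_mul] using this
  have h12 : cyclotomic 12 ℤ = X ^ 4 - X ^ 2 + 1 := by
    have := (cyclotomic_expand_eq_cyclotomic Nat.prime_two (n := 6) (by norm_num) ℤ).symm
    rw [cyclotomic_six] at this
    simpa [← pow_mul] using this
  have h24 : cyclotomic 24 ℤ = X ^ 8 - X ^ 4 + 1 := by
    have := (cyclotomic_expand_eq_cyclotomic Nat.prime_two (n := 12) (by norm_num) ℤ).symm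
    rw [h12] at this
    simpa [← pow_mul] using this
  have hx2 : x ≤ x ^ 2 := Nat.le_self_pow two_ne_zero x
  have hx4 : x ^ 2 ≤ x ^ 4 := Nat.pow_le_pow_right hx (by norm_num)
  have hx8 : x ^ 4 ≤ x ^ 8 := Nat.pow_le_pow_right hx (by norm_num)
  simp only [divisors_twentyFour, Finset.mem_insert, Finset.mem_singleton] at hd
  rcases hd with rfl | rfl | rfl | rfl | rfl | rfl | rfl | rfl <;>
    simp [cyclotomicNat, cyclotomic_six, cyclotomic_three, h4, h8, h12, h24, Nat.cast_sub hx,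
      Nat.cast_sub hx2, Nat.cast_sub hx4, Nat.cast_sub hx8]

theorem decimalLength_eq {n l : ℕ} (h1 : 10 ^ (l - 1) ≤ n) (h2 : n < 10 ^ l) :
    decimalLength n = l := by
  have h3 := (Nat.digits_length_le_iff (b := 10) (k := l) (by norm_num) n).mpr h2
  have h4 := (Nat.lt_digits_length_iff (b := 10) (k := l - 1) (by norm_num) n).mpr h1
  rw [decimalLength]
  omega

/-- Certifies that `n` has `l` decimal digits. -/
def hasDigits (n l : ℕ) : Bool := decide (10 ^ (l - 1) ≤ n) && decide (n < 10 ^ l)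

theorem decimalLength_of_hasDigits {n l : ℕ} (h : hasDigits n l = true) : decimalLength n = l := by
  simp only [hasDigits, Bool.and_eq_true, decide_eq_true_eq] at h
  exact decimalLength_eq h.1 h.2

namespace PrimeData

/-- The cofactor of `2 ^ exponent` as a computable natural number. -/
def factorNat (s : PrimeData) (j : ℕ) : ℕ :=
  force (2 ^ j) fun x => ∏ d ∈ s.A, cyclotomicNat x d

/-- The number described by a `PrimeData` as a computable natural number. -/
def valueNat (s : PrimeData) (j k : ℕ) : ℕ :=
  2 ^ (k + 1) + 2 ^ s.exponent * s.factorNat j - 1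

/-- Certifies the listed properties of the number described by a `PrimeData`. -/
def certificate (s : PrimeData) (j k : ℕ) : Bool :=
  decide (0 ≤ s.P) && force (s.valueNat j k) fun n =>
    lucasCertificate n s.P.toNat s.exponent && s.test.certificate n s.exponent &&
    hasDigits n s.digitLength

variable {s : PrimeData} {j k : ℕ}

theorem factor_eq (hA : s.A ⊆ Nat.divisors 24) : s.factor j = s.factorNat j := by
  rw [factor, cyclotomicValue, factorNat, force_eq, Nat.cast_prod]
  refine Finset.prod_congr rfl fun d hd => ?_
  have := eval_cyclotomic_of_dvd_twentyFour (hA hd) (x := 2 ^ j) (by positivity)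
  push_cast at this
  exact this

theorem valueNat_add_one :
    s.valueNat j k + 1 = 2 ^ (k + 1) + 2 ^ s.exponent * s.factorNat j := by
  have : 0 < 2 ^ (k + 1) := by positivity
  rw [valueNat]
  omega

theorem value_eq (hA : s.A ⊆ Nat.divisors 24) : s.value j k = s.valueNat j k := by
  have h := valueNat_add_one (s := s) (j := j) (k := k)
  zify at h
  rw [value, factor_eq hA, ← h, add_sub_cancel_right, Int.toNat_natCast]

theorem passes_of_certificate (h : s.certificate j k = true) :
    s.test.Passes (s.valueNat j k) s.P s.exponent ∧
      decimalLength (s.valueNat j k) = s.digitLength := by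
  simp only [certificate, force_eq, Bool.and_eq_true, decide_eq_true_eq] at h
  obtain ⟨hP, ⟨hL, ht⟩, hd⟩ := h
  have := LucasTest.passes_of_certificate hL ht
  rw [Int.toNat_of_nonneg hP] at this
  exact ⟨this, decimalLength_of_hasDigits hd⟩

end PrimeData

namespace Entry

/-- The number `2 ^ k * p * q` as a computable natural number. -/
def numberNat (r : Entry) : ℕ := 2 ^ r.k * r.first.valueNat r.j r.k * r.second.valueNat r.j r.k

/-- Certifies all listed properties of an entry. -/
def certificate (r : Entry) : Bool :=
  decide (r.k = 24 * r.j) && decide (0 < r.k) &&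
  decide (r.first.A ∪ r.second.A = {1, 2, 3, 4, 6, 8, 12, 24}) &&
  decide (Disjoint r.first.A r.second.A) &&
  decide (0 < r.first.exponent) && decide (0 < r.second.exponent) &&
  decide (r.first.exponent + r.second.exponent = r.k + 2) &&
  decide (r.first.factorNat r.j * r.second.factorNat r.j + 1 = 2 ^ r.k) &&
  decide (r.first.valueNat r.j r.k ≠ r.second.valueNat r.j r.k) &&
  r.first.certificate r.j r.k && r.second.certificate r.j r.k && hasDigits r.numberNat r.digitLength

end Entry

theorem certificate_of_mem_largeWeirdTable : ∀ r ∈ largeWeirdTable, r.certificate = true := by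
  rw [← List.forall_iff_forall_mem]
  simp only [largeWeirdTable, List.Forall]
  repeat' apply And.intro
  all_goals decide +kernel

theorem card_numberNat_largeWeirdTable :
    (largeWeirdTable.map Entry.numberNat).toFinset.card = 64 := by
  decide +kernel

theorem Entry.number_eq {r : Entry} (hA : r.first.A ⊆ Nat.divisors 24)
    (hB : r.second.A ⊆ Nat.divisors 24) : r.number = r.numberNat := by
  rw [number, numberNat, p, q, PrimeData.value_eq hA, PrimeData.value_eq hB]

theorem Entry.number_eq_of_certificate {r : Entry} (h : r.certificate = true) :
    r.number = r.numberNat := by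
  simp only [certificate, Bool.and_eq_true, decide_eq_true_eq] at h
  obtain ⟨⟨⟨⟨⟨⟨⟨⟨⟨⟨⟨-, -⟩, hAB⟩, -⟩, -⟩, -⟩, -⟩, -⟩, -⟩, -⟩, -⟩, -⟩ := h
  rw [← divisors_twentyFour] at hAB
  exact number_eq (hAB ▸ Finset.subset_union_left) (hAB ▸ Finset.subset_union_right)

theorem Entry.properties_of_certificate {r : Entry} (h : r.certificate = true) :
    r.k = 24 * r.j ∧
    r.first.A ∪ r.second.A = Nat.divisors 24 ∧ Disjoint r.first.A r.second.A ∧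
    r.u * r.v = 2 ^ r.k - 1 ∧
    (∃ i ≤ r.k, r.first.exponent = i + 1 ∧ r.second.exponent = r.k - i + 1 ∧
      (r.p : ℤ) = (2 ^ (r.k + 1) - 1) + 2 ^ (i + 1) * r.u ∧
      (r.p : ℤ) = 2 ^ (i + 1) * (2 ^ (r.k - i) + r.u) - 1 ∧
      (r.q : ℤ) = (2 ^ (r.k + 1) - 1) + 2 ^ (r.k - i + 1) * r.v ∧
      (r.q : ℤ) = 2 ^ (r.k - i + 1) * (2 ^ i + r.v) - 1) ∧
    r.p.Prime ∧ r.q.Prime ∧ Odd r.p ∧ Odd r.q ∧ r.p ≠ r.q ∧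
    r.first.test.Passes r.p r.first.P r.first.exponent ∧
    r.second.test.Passes r.q r.second.P r.second.exponent ∧
    decimalLength r.p = r.first.digitLength ∧
    decimalLength r.q = r.second.digitLength ∧
    decimalLength r.number = r.digitLength ∧
    PrimitiveWeird r.number := by
  have hnum := number_eq_of_certificate h
  simp only [certificate, Bool.and_eq_true, decide_eq_true_eq] at h
  obtain ⟨⟨⟨⟨⟨⟨⟨⟨⟨⟨⟨hk, hk0⟩, hAB⟩, hdisj⟩, he₁⟩, he₂⟩, he⟩, huv⟩, hne⟩, h₁⟩, h₂⟩, hd⟩ := h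
  rw [← divisors_twentyFour] at hAB
  have hA : r.first.A ⊆ Nat.divisors 24 := hAB ▸ Finset.subset_union_left
  have hB : r.second.A ⊆ Nat.divisors 24 := hAB ▸ Finset.subset_union_right
  have hp : r.p = r.first.valueNat r.j r.k := PrimeData.value_eq hA
  have hq : r.q = r.second.valueNat r.j r.k := PrimeData.value_eq hB
  have hu : r.u = r.first.factorNat r.j := PrimeData.factor_eq hA
  have hv : r.v = r.second.factorNat r.j := PrimeData.factor_eq hB
  obtain ⟨t₁, d₁⟩ := PrimeData.passes_of_certificate h₁
  obtain ⟨t₂, d₂⟩ := PrimeData.passes_of_certificate h₂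
  have hp1 := PrimeData.valueNat_add_one (s := r.first) (j := r.j) (k := r.k)
  have hq1 := PrimeData.valueNat_add_one (s := r.second) (j := r.j) (k := r.k)
  rw [← hp] at t₁ d₁ hne hp1
  rw [← hq] at t₂ d₂ hne hq1
  obtain ⟨i, hi⟩ : ∃ i, r.first.exponent = i + 1 := ⟨r.first.exponent - 1, by omega⟩
  have hik : i ≤ r.k := by omega
  have hi' : r.second.exponent = r.k - i + 1 := by omega
  have hodd : ∀ {n s e : ℕ}, n + 1 = 2 ^ (r.k + 1) + 2 ^ e * s → 0 < e → Odd n := by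
    intro n s e hn he0
    have : Even (n + 1) := by
      rw [hn, even_iff_two_dvd]
      exact dvd_add (dvd_pow_self 2 (by omega)) ((dvd_pow_self 2 he0.ne').mul_right s)
    simpa [Nat.even_add_one] using this
  have hpos : 1 < 2 ^ r.k := Nat.one_lt_two_pow hk0.ne'
  have hu0 : 0 < r.first.factorNat r.j := Nat.pos_of_ne_zero fun h0 => by
    rw [h0, zero_mul] at huv; omega
  have hv0 : 0 < r.second.factorNat r.j := Nat.pos_of_ne_zero fun h0 => by
    rw [h0, mul_zero] at huv; omega
  have two_le : ∀ {s e : ℕ}, 0 < s → 0 < e → 2 ≤ 2 ^ e * s := fun hs he0 =>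
    calc 2 = 2 ^ 1 * 1 := rfl
      _ ≤ _ := Nat.mul_le_mul (Nat.pow_le_pow_right two_pos he0) hs
  refine ⟨hk, hAB, hdisj, ?_, ⟨i, hik, hi, hi', ?_, ?_, ?_, ?_⟩, t₁.prime, t₂.prime, hodd hp1 he₁,
    hodd hq1 he₂, hne, t₁, t₂, d₁, d₂, ?_, ?_⟩
  · rw [hu, hv, eq_sub_iff_add_eq]
    exact_mod_cast huv
  · zify at hp1
    rw [hu, ← hi]
    linear_combination hp1
  · zify at hp1
    rw [hu]
    rw [hi, show r.k + 1 = (i + 1) + (r.k - i) by omega, pow_add] at hp1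
    linear_combination hp1
  · zify at hq1
    rw [hv, ← hi']
    linear_combination hq1
  · zify at hq1
    rw [hv]
    rw [hi', show r.k + 1 = (r.k - i + 1) + i by omega, pow_add] at hq1
    linear_combination hq1
  · rw [hnum]
    exact decimalLength_of_hasDigits hd
  · refine primitiveWeird_two_pow_mul_mul t₁.prime t₂.prime hne (two_le hu0 he₁) (two_le hv0 he₂)
      hp1 hq1 ?_
    rw [← he, pow_add, ← huv]
    ring

theorem mainTheorem4 :
    -- passing one of the tests certifies primality
    (∀ (t : LucasTest) (n : ℕ) (P : ℤ) (e : ℕ), t.Passes n P e → n.Prime) ∧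
    -- there are 66 entries, describing 64 different numbers
    largeWeirdTable.length = 66 ∧
    (largeWeirdTable.map Entry.number).toFinset.card = 64 ∧
    (∀ r ∈ largeWeirdTable,
      -- `2 ^ k - 1 = u * v` is split by distributing the factors `Φ_d (2 ^ j)`, `d ∣ 24`
      r.k = 24 * r.j ∧
      r.first.A ∪ r.second.A = Nat.divisors 24 ∧ Disjoint r.first.A r.second.A ∧
      r.u * r.v = 2 ^ r.k - 1 ∧
      -- the form of `p` and `q`
      (∃ i ≤ r.k, r.first.exponent = i + 1 ∧ r.second.exponent = r.k - i + 1 ∧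
        (r.p : ℤ) = (2 ^ (r.k + 1) - 1) + 2 ^ (i + 1) * r.u ∧
        (r.p : ℤ) = 2 ^ (i + 1) * (2 ^ (r.k - i) + r.u) - 1 ∧
        (r.q : ℤ) = (2 ^ (r.k + 1) - 1) + 2 ^ (r.k - i + 1) * r.v ∧
        (r.q : ℤ) = 2 ^ (r.k - i + 1) * (2 ^ i + r.v) - 1) ∧
      -- `p` and `q` are different odd primes, and the listed tests certify this
      r.p.Prime ∧ r.q.Prime ∧ Odd r.p ∧ Odd r.q ∧ r.p ≠ r.q ∧
      r.first.test.Passes r.p r.first.P r.first.exponent ∧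
      r.second.test.Passes r.q r.second.P r.second.exponent ∧
      -- the digit lengths
      decimalLength r.p = r.first.digitLength ∧
      decimalLength r.q = r.second.digitLength ∧
      decimalLength r.number = r.digitLength ∧
      -- the number is primitive weird
      PrimitiveWeird r.number) ∧
    -- the digit lengths range from 219 to 2077
    IsLeast {l | ∃ r ∈ largeWeirdTable, l = decimalLength r.number} 219 ∧
    IsGreatest {l | ∃ r ∈ largeWeirdTable, l = decimalLength r.number} 2077 := by
  have hprop := fun r hr => Entry.properties_of_certificate (certificate_of_mem_largeWeirdTable r hr)
  have hlen : ∀ r ∈ largeWeirdTable, decimalLength r.number = r.digitLength := fun r hr =>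
    (hprop r hr).2.2.2.2.2.2.2.2.2.2.2.2.2.2.1
  refine ⟨fun _ _ _ _ h => h.prime, rfl, ?_, hprop, ⟨?_, ?_⟩, ⟨?_, ?_⟩⟩
  · rw [← card_numberNat_largeWeirdTable]
    congr 2
    exact List.map_congr_left fun r hr =>
      Entry.number_eq_of_certificate (certificate_of_mem_largeWeirdTable r hr)
  · obtain ⟨r, hr, h⟩ : ∃ r ∈ largeWeirdTable, r.digitLength = 219 :=
      ⟨_, List.mem_cons_self, rfl⟩
    exact ⟨r, hr, by rw [hlen r hr, h]⟩
  · rintro _ ⟨r, hr, rfl⟩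
    rw [hlen r hr]
    revert r
    decide +kernel
  · obtain ⟨r, hr, h⟩ : ∃ r ∈ largeWeirdTable, r.digitLength = 2077 := by decide +kernel
    exact ⟨r, hr, by rw [hlen r hr, h]⟩
  · rintro _ ⟨r, hr, rfl⟩
    rw [hlen r hr]
    revert r
    decide +kernel
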